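/- Let $\mathscr A(\mathbb R)$ be the space of complex-valued real analytic functions on $\mathbb R$, with its natural locally convex inductive limit topology $\mathscr A(\mathbb R)=\operatorname{ind}_{U\supset\mathbb R}H(U)$, where $U$ runs over all open subsets of $\mathbb C$ containing $\mathbb R$ and the space $H(U)$ of holomorphic functions on $U$ carries the compact-open topology. Let $H$ be the Hardy operator on $\mathscr A(\mathbb R)$, $Hf(x)=\frac1x\int_0^x f(y)\,dy$ for $x\neq 0$ and $Hf(0)=f(0)$. Then $H$ is a continuous linear operator on $\mathscr A(\mathbb R)$, and for every $K\ge 0$ and all $a_0,\dots,a_K\in\mathbb C$ the operator $A=\sum_{k=0}^K a_kH^k$ (where $H^0=I$) generates a $C_0$-group on $\mathscr A(\mathbb R)$: there is a family $(T_t)_{t\in\mathbb R}$ of continuous linear operators on $\mathscr A(\mathbb R)$ with $T_{s+t}=T_sT_t$ for all $s,t\in\mathbb R$, $T_0=I$ and $\lim_{t\to s}T_tf=T_sf$ for all $f\in\mathscr A(\mathbb R)$, $s\in\mathbb R$, whose generator is $A$ with domain all of $\mathscr A(\mathbb R)$; that is, for all $f,g\in\mathscr A(\mathbb R)$, $\frac{T_tf-f}{t}\to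 g$ as $t\to0$ if and only if $g=Af$. -/

import Mathlib

open Set Filter Topology MeasureTheory TopologicalSpace

/-! ### The space `H(U)` of holomorphic functions with the compact-open topology -/

/-- `H(U)`: the holomorphic functions on the open set `U ⊆ ℂ`, as a subspace of the space
`C(U, ℂ)` of continuous functions. It carries the subspace topology of the compact-open topology
of `C(U, ℂ)`, i.e. the topology of uniform convergence on compact subsets of `U`. -/
def HolomorphicOn (U : Opens ℂ) : Submodule ℂ C(U, ℂ) where
  carrier := {g | ∃ G : ℂ → ℂ, DifferentiableOn ℂ G U ∧ ∀ z : U, G z = g z}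
  add_mem' := by
    rintro g₁ g₂ ⟨G₁, hG₁, h₁⟩ ⟨G₂, hG₂, h₂⟩
    exact ⟨fun z => G₁ z + G₂ z, hG₁.fun_add hG₂, fun z => by simp [h₁, h₂]⟩
  zero_mem' := ⟨fun _ => 0, differentiableOn_const 0, fun z => by simp⟩
  smul_mem' := by
    rintro c g ⟨G, hG, h⟩
    exact ⟨fun z => c * G z, hG.const_mul c, fun z => by simp [h]⟩

/-! ### The space `𝒜(ℝ)` of real analytic functions -/

/-- The complex vector space of (complex valued) real analytic functions on `ℝ`. -/
def realAnalyticSubmodule : Submodule ℂ (ℝ → ℂ) where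
  carrier := {f | ∀ x : ℝ, AnalyticAt ℝ f x}
  add_mem' := fun hf hg x => (hf x).add (hg x)
  zero_mem' := fun _ => analyticAt_const
  smul_mem' := fun c _ hf x => (analyticAt_const (v := c)).mul (hf x)

/-- `𝒜(ℝ)`: the space of real analytic functions on `ℝ`. This is a separate type, so that it does
not inherit the topology of pointwise convergence; its topology is defined below. -/
def RealAnalytic : Type := realAnalyticSubmodule

namespace RealAnalytic

instance : AddCommGroup RealAnalytic := inferInstanceAs (AddCommGroup realAnalyticSubmodule)
instance : Module ℂ RealAnalytic := inferInstanceAs (Module ℂ realAnalyticSubmodule)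
instance : Module ℝ RealAnalytic := inferInstanceAs (Module ℝ realAnalyticSubmodule)
instance : IsScalarTower ℝ ℂ RealAnalytic :=
  inferInstanceAs (IsScalarTower ℝ ℂ realAnalyticSubmodule)

instance : FunLike RealAnalytic ℝ ℂ where
  coe f := f.1
  coe_injective := Subtype.val_injective

@[ext] theorem ext {f g : RealAnalytic} (h : ∀ x, f x = g x) : f = g := DFunLike.ext f g h

theorem analyticAt (f : RealAnalytic) (x : ℝ) : AnalyticAt ℝ f x := f.2 x

theorem continuous_coe (f : RealAnalytic) : Continuous f :=
  continuous_iff_continuousAt.2 fun x => (f.analyticAt x).continuousAt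

@[simp] theorem add_apply (f g : RealAnalytic) (x : ℝ) : (f + g) x = f x + g x := rfl

@[simp] theorem smul_apply (c : ℂ) (f : RealAnalytic) (x : ℝ) : (c • f) x = c * f x := rfl

/-- The restriction map `H(U) → 𝒜(ℝ)` for a complex neighbourhood `U` of `ℝ`. -/
noncomputable def restrict (U : Opens ℂ) (hU : ∀ x : ℝ, (x : ℂ) ∈ U) : HolomorphicOn U →ₗ[ℂ] RealAnalytic where
  toFun g := ⟨fun x => g.1 ⟨(x : ℂ), hU x⟩, by
    obtain ⟨G, hG, h⟩ := g.2
    intro x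
    have h1 : AnalyticAt ℂ G (x : ℂ) := hG.analyticAt (U.isOpen.mem_nhds (hU x))
    have h2 : AnalyticAt ℝ (fun y : ℝ => G (y : ℂ)) x :=
      AnalyticAt.comp (g := G) (f := fun y : ℝ => (y : ℂ)) h1.restrictScalars
        (Complex.ofRealCLM.analyticAt x)
    have h3 : (fun y : ℝ => g.1 ⟨(y : ℂ), hU y⟩) = fun y : ℝ => G (y : ℂ) :=
      funext fun y => (h ⟨(y : ℂ), hU y⟩).symm
    rw [h3]
    exact h2⟩
  map_add' _ _ := rfl
  map_smul' _ _ := rfl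

/-- The natural topology of `𝒜(ℝ)`: the topology of the locally convex inductive limit
`ind H(U)` over all complex neighbourhoods `U` of `ℝ`, i.e. the finest locally convex
vector space topology for which all restriction maps `H(U) → 𝒜(ℝ)` are continuous.
(In Mathlib `s ≤ t` means that `s` is finer than `t`.) -/
instance : TopologicalSpace RealAnalytic :=
  sInf {t : TopologicalSpace RealAnalytic |
    (∀ (U : Opens ℂ) (hU : ∀ x : ℝ, (x : ℂ) ∈ U), Continuous[inferInstance, t] (restrict U hU)) ∧
    @IsTopologicalAddGroup RealAnalytic t _ ∧
    @ContinuousSMul ℂ RealAnalytic _ _ t ∧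
    @LocallyConvexSpace ℝ RealAnalytic _ _ _ _ t}

instance : IsTopologicalAddGroup RealAnalytic :=
  topologicalAddGroup_sInf fun _ ht => ht.2.1

instance : ContinuousSMul ℂ RealAnalytic :=
  continuousSMul_sInf fun _ ht => ht.2.2.1

instance : LocallyConvexSpace ℝ RealAnalytic :=
  .sInf fun _ ht => ht.2.2.2

/-- The restriction maps are continuous for the inductive limit topology. -/
theorem continuous_restrict (U : Opens ℂ) (hU : ∀ x : ℝ, (x : ℂ) ∈ U) :
    Continuous (restrict U hU) :=
  continuous_sInf_rng.2 fun _ ht => ht.1 U hU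

/-! ### The Hardy operator -/

/-- A function that is real analytic at a point extends holomorphically to a complex disc. -/
theorem exists_holomorphic_extension {f : ℝ → ℂ} {a : ℝ} (hf : AnalyticAt ℝ f a) :
    ∃ (G : ℂ → ℂ) (r : ℝ), 0 < r ∧ DifferentiableOn ℂ G (Metric.ball (a : ℂ) r) ∧
      ∀ x : ℝ, (x : ℂ) ∈ Metric.ball (a : ℂ) r → G x = f x := by
  obtain ⟨p, R, hp⟩ := hf
  set q : FormalMultilinearSeries ℂ ℂ ℂ := FormalMultilinearSeries.ofScalars ℂ p.coeff with hq
  have hrad : p.radius ≤ q.radius := by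
    refine ENNReal.le_of_forall_nnreal_lt fun r hr => ?_
    obtain ⟨C, -, hC⟩ := p.norm_mul_pow_le_of_lt_radius hr
    refine q.le_radius_of_bound C fun n => ?_
    rw [hq, FormalMultilinearSeries.ofScalars_norm, ← FormalMultilinearSeries.norm_apply_eq_norm_coef]
    exact hC n
  have hqpos : 0 < q.radius := (hp.r_pos.trans_le hp.r_le).trans_le hrad
  have hqs := q.hasFPowerSeriesOnBall hqpos
  obtain ⟨r, hr0, hr⟩ := ENNReal.lt_iff_exists_nnreal_btwn.1 hp.r_pos
  refine ⟨fun z => q.sum (z - a), r, by exact_mod_cast hr0, ?_, ?_⟩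
  · refine DifferentiableOn.comp (t := Metric.eball 0 q.radius) (g := q.sum)
      (f := fun z : ℂ => z - a) hqs.differentiableOn
      ((differentiable_id.sub_const _).differentiableOn) ?_
    intro z hz
    have h1 : z - (a : ℂ) ∈ Metric.ball (0 : ℂ) r := by simpa [dist_eq_norm] using hz
    have h2 : z - (a : ℂ) ∈ Metric.eball (0 : ℂ) r := by
      rwa [Metric.eball_coe]
    exact Metric.eball_subset_eball ((hr.le.trans hp.r_le).trans hrad) h2
  · intro x hx
    have h1 : x - a ∈ Metric.ball (0 : ℝ) r := by
      rw [mem_ball_zero_iff]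
      rw [mem_ball_iff_norm, ← Complex.ofReal_sub, Complex.norm_real] at hx
      exact hx
    have h2 : x - a ∈ Metric.eball (0 : ℝ) R := by
      rw [← Metric.eball_coe] at h1
      exact Metric.eball_subset_eball hr.le h1
    have h3 := (hp.hasSum h2).tsum_eq
    rw [add_sub_cancel] at h3
    rw [← h3]
    refine tsum_congr fun n => ?_
    rw [hq, FormalMultilinearSeries.ofScalars_apply_eq,
      FormalMultilinearSeries.apply_eq_pow_smul_coeff, ← Complex.ofReal_sub, ← Complex.ofReal_pow,
      Complex.real_smul, smul_eq_mul, mul_comm]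

theorem analyticAt_primitive (f : RealAnalytic) (a : ℝ) :
    AnalyticAt ℝ (fun x : ℝ => ∫ y in (0 : ℝ)..x, f y) a := by
  obtain ⟨G, r, hr, hG, hGf⟩ := exists_holomorphic_extension (f.analyticAt a)
  obtain ⟨P, hP⟩ := hG.isExactOn_ball
  have hPd : DifferentiableOn ℂ P (Metric.ball (a : ℂ) r) := fun z hz =>
    (hP z hz).differentiableAt.differentiableWithinAt
  have hPa : AnalyticAt ℝ (fun y : ℝ => P (y : ℂ)) a :=
    AnalyticAt.comp (g := P) (f := fun y : ℝ => (y : ℂ))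
      (hPd.analyticAt (Metric.isOpen_ball.mem_nhds (Metric.mem_ball_self hr))).restrictScalars
      (Complex.ofRealCLM.analyticAt a)
  have hmem : ∀ x ∈ Metric.ball a r, (x : ℂ) ∈ Metric.ball (a : ℂ) r := by
    intro x hx
    rw [mem_ball_iff_norm, ← Complex.ofReal_sub, Complex.norm_real]
    rwa [mem_ball_iff_norm] at hx
  have hPr : ∀ x ∈ Metric.ball a r, HasDerivAt (fun y : ℝ => P (y : ℂ)) (f x) x := by
    intro x hx
    have h := (hP _ (hmem x hx)).comp_ofReal
    rwa [hGf x (hmem x hx)] at h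
  refine (hPa.add (analyticAt_const (v := (∫ y in (0 : ℝ)..a, f y) - P a))).congr ?_
  filter_upwards [Metric.ball_mem_nhds a hr] with x hx
  have hsub : uIcc a x ⊆ Metric.ball a r :=
    (convex_ball a r).ordConnected.uIcc_subset (Metric.mem_ball_self hr) hx
  have h1 : ∫ y in a..x, f y = P x - P a :=
    intervalIntegral.integral_eq_sub_of_hasDerivAt (fun y hy => hPr y (hsub hy))
      (f.continuous_coe.intervalIntegrable _ _)
  have h2 := intervalIntegral.integral_add_adjacent_intervals
    (f.continuous_coe.intervalIntegrable (μ := volume) 0 a)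
    (f.continuous_coe.intervalIntegrable (μ := volume) a x)
  rw [h1] at h2
  simp only [Pi.add_apply]
  rw [← h2]
  ring

/-- `Hf(x) = (1/x) ∫₀ˣ f(y) dy` for `x ≠ 0`, extended to `x = 0` by its limit `f(0)`. -/
noncomputable def hardyFun (f : ℝ → ℂ) (x : ℝ) : ℂ :=
  if x = 0 then f 0 else (1 / (x : ℂ)) * ∫ y in (0 : ℝ)..x, f y

theorem analyticAt_hardyFun (f : RealAnalytic) (a : ℝ) : AnalyticAt ℝ (hardyFun f) a := by
  set F : ℝ → ℂ := fun x => ∫ y in (0 : ℝ)..x, f y with hF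
  have hd : deriv F 0 = f 0 := f.continuous_coe.deriv_integral _ 0 0
  have h : hardyFun f = dslope F 0 := by
    funext x
    by_cases hx : x = 0
    · simp [hardyFun, hx, hd]
    · rw [dslope_of_ne _ hx, slope_def_module]
      simp [hardyFun, hx, hF]
  by_cases ha : a = 0
  · subst ha
    obtain ⟨p, hp⟩ := analyticAt_primitive f 0
    rw [h]
    exact ⟨_, hp.has_fpower_series_dslope_fslope⟩
  · have h1 : AnalyticAt ℝ (fun x : ℝ => x⁻¹ • F x) a :=
      (analyticAt_id.inv ha).smul (analyticAt_primitive f a)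
    refine h1.congr ?_
    filter_upwards [isOpen_ne.mem_nhds ha] with x hx
    simp only [hardyFun, if_neg hx]
    simp [hF]

/-- The Hardy operator `H` on `𝒜(ℝ)`. -/
noncomputable def hardy : RealAnalytic →ₗ[ℂ] RealAnalytic where
  toFun f := ⟨hardyFun f, analyticAt_hardyFun f⟩
  map_add' f g := by
    ext x
    change hardyFun (f + g : RealAnalytic) x = hardyFun f x + hardyFun g x
    by_cases hx : x = 0
    · simp [hardyFun, hx]
    · simp only [hardyFun, hx, if_false, add_apply]
      rw [intervalIntegral.integral_add (f.continuous_coe.intervalIntegrable _ _)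
        (g.continuous_coe.intervalIntegrable _ _), mul_add]
  map_smul' c f := by
    ext x
    change hardyFun (c • f : RealAnalytic) x = c * hardyFun f x
    by_cases hx : x = 0
    · simp [hardyFun, hx]
    · simp only [hardyFun, hx, if_false, smul_apply]
      rw [intervalIntegral.integral_const_mul]
      ring

end RealAnalytic

/-! ### Strongly continuous groups and their generators -/

section Groups

/-- `(T_t)_{t ∈ ℝ}` is a `C₀`-group of continuous linear operators on `X`. -/
structure IsC0Group {X : Type*} [AddCommGroup X] [Module ℂ X] [TopologicalSpace X]
    (T : ℝ → X →L[ℂ] X) : Prop where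
  map_add : ∀ s t : ℝ, T (s + t) = (T s).comp (T t)
  map_zero : T 0 = ContinuousLinearMap.id ℂ X
  tendsto : ∀ (x : X) (s : ℝ), Tendsto (fun t => T t x) (𝓝 s) (𝓝 (T s x))

/-- The generator of `(T_t)_{t ∈ ℝ}`, as a graph: the set of all pairs `(x, y)` such that
`(T_t x - x) / t → y` as `t → 0`. -/
def generatorGraph {X : Type*} [AddCommGroup X] [Module ℂ X] [TopologicalSpace X]
    (T : ℝ → X →L[ℂ] X) : Set (X × X) :=
  {p | Tendsto (fun t : ℝ => ((t : ℂ)⁻¹) • (T t p.1 - p.1)) (𝓝[≠] 0) (𝓝 p.2)}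

/-- The everywhere defined operator `A` generates a `C₀`-group: it is the generator (with the same
domain, namely all of `X`) of some `C₀`-group on `X`. -/
def GeneratesC0Group {X : Type*} [AddCommGroup X] [Module ℂ X] [TopologicalSpace X]
    (A : X →ₗ[ℂ] X) : Prop :=
  ∃ T : ℝ → X →L[ℂ] X, IsC0Group T ∧ generatorGraph T = {p | p.2 = A p.1}

end Groups

/-! ### Holomorphic functions along rays -/

/-! Since `Hf(x) = ∫₀¹ f(qx) dq`, the value of `Hf` at `x` depends only on the ray `f_x = (s ↦
f(sx))`, an element of the Banach space `C([0,1])`. A bounded operator `B` on `C([0,1])` thus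
induces `lift B f (x) = (B f_x)(1)`. If `B` commutes with all dilations, then `(lift B f)_x = B f_x`
(`ray_lift`), so lifting respects products (`lift_mul`). The bounded Hardy operator on `C([0,1])`
commutes with dilations and lifts to `H`; hence `A` is the lift of a bounded `B`, and the lifts of
`exp(tB)` form the group.

The topology enters twice. Every neighbourhood of `ℝ` contains a star-shaped one `S`, and the
induced operators preserve `H(S)`, hence are continuous. For fixed `f`, the vector `lift B f`
depends continuously on `B` in norm (`continuous_lift_left`), so strong continuity and the
derivative at `0` pass from `exp(tB)` to its lift. -/

/-- The ray `s ↦ s z` from `0` to `z` stays in `S` for all `z ∈ S`. -/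
def IsStarShaped (S : Opens ℂ) : Prop :=
  ∀ z ∈ S, ∀ s : unitInterval, ((s : ℝ) : ℂ) * z ∈ S

/-- The multiplication `(z, s) ↦ s z` on a star-shaped open set. -/
noncomputable def IsStarShaped.scale {S : Opens ℂ} (hS : IsStarShaped S) : C(S × unitInterval, S) where
  toFun p := ⟨((p.2 : ℝ) : ℂ) * p.1, hS _ p.1.2 p.2⟩
  continuous_toFun := by fun_prop

/-- The map sending `z` to the restriction `s ↦ g (s z)` of `g` to the segment `[0, z]`. -/
noncomputable def IsStarShaped.rays {S : Opens ℂ} (hS : IsStarShaped S) (g : C(S, ℂ)) :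
    C(S, C(unitInterval, ℂ)) :=
  (g.comp hS.scale).curry

theorem IsStarShaped.rays_apply {S : Opens ℂ} (hS : IsStarShaped S) (g : C(S, ℂ)) (z : S)
    (s : unitInterval) : hS.rays g z s = g ⟨((s : ℝ) : ℂ) * z, hS _ z.2 s⟩ := rfl

theorem IsStarShaped.continuous_rays {S : Opens ℂ} (hS : IsStarShaped S) :
    Continuous hS.rays := by
  have : LocallyCompactSpace S := S.isOpen.locallyCompactSpace
  exact ContinuousMap.continuous_curry.comp (ContinuousMap.continuous_precomp hS.scale)

/-- Every open set containing `ℝ` contains a star-shaped one that still contains `ℝ`. -/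
theorem exists_isStarShaped_le (U : Opens ℂ) (hU : ∀ x : ℝ, (x : ℂ) ∈ U) :
    ∃ S : Opens ℂ, IsStarShaped S ∧ S ≤ U ∧ ∀ x : ℝ, (x : ℂ) ∈ S := by
  let m : C(ℂ, C(unitInterval, ℂ)) :=
    ContinuousMap.curry ⟨fun p => ((p.2 : ℝ) : ℂ) * p.1, by fun_prop⟩
  have hm : ∀ z s, m z s = ((s : ℝ) : ℂ) * z := fun _ _ => rfl
  -- These are the points whose segment to `0` lies in `U`; compactness of `[0,1]` makes this set
  -- open.
  have hopen : IsOpen {z : ℂ | ∀ s : unitInterval, ((s : ℝ) : ℂ) * z ∈ U} := by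
    have := (ContinuousMap.isOpen_setOfPred_mapsTo (X := unitInterval) (Y := ℂ) isCompact_univ
      U.isOpen).preimage m.continuous
    convert this using 1
    ext z
    simp [MapsTo, hm]
  refine ⟨⟨_, hopen⟩, ?_, ?_, ?_⟩
  · intro z hz s t
    have := hz (t * s)
    rwa [Icc.coe_mul, Complex.ofReal_mul, mul_assoc] at this
  · intro z hz
    simpa using hz 1
  · intro x s
    rw [← Complex.ofReal_mul]
    exact hU _

/-- If `G` is holomorphic on a star-shaped open set, then `z ↦ (s ↦ G (s z))` is holomorphic as a
map with values in the Banach space of continuous functions on the unit interval. -/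
theorem IsStarShaped.differentiableOn_rays {S : Opens ℂ} (hS : IsStarShaped S) {G : ℂ → ℂ}
    (hG : DifferentiableOn ℂ G S) {Γ : ℂ → C(unitInterval, ℂ)} (hΓc : ContinuousOn Γ S)
    (hΓ : ∀ z ∈ S, ∀ s : unitInterval, Γ z s = G (((s : ℝ) : ℂ) * z)) :
    DifferentiableOn ℂ Γ S := by
  intro c hc
  obtain ⟨r, hr, hrS⟩ := Metric.nhds_basis_closedBall.mem_iff.1 (S.isOpen.mem_nhds hc)
  lift r to NNReal using hr.le
  have hint : CircleIntegrable Γ c r :=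
    (hΓc.mono (Metric.sphere_subset_closedBall.trans hrS)).circleIntegrable r.2
  -- The Cauchy integral of the merely continuous `Γ` is analytic. It equals `Γ`, because evaluation
  -- at each `s` commutes with the integral and yields the scalar Cauchy formula.
  have hps := hasFPowerSeriesOn_cauchy_integral hint (by exact_mod_cast hr)
  refine (hps.analyticAt.differentiableAt.congr_of_eventuallyEq ?_).differentiableWithinAt
  filter_upwards [Metric.ball_mem_nhds c hr] with w hw
  ext s
  have hd : DifferentiableOn ℂ (fun z => G (((s : ℝ) : ℂ) * z)) (Metric.closedBall c r) :=
    hG.comp (differentiable_id.const_mul _).differentiableOn fun z hz => hS z (hrS hz) s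
  have h1 := Complex.two_pi_I_inv_smul_circleIntegral_sub_inv_smul_of_differentiable_on_off_countable
    countable_empty hw hd.continuousOn fun z hz =>
      hd.differentiableAt (Metric.closedBall_mem_nhds_of_mem hz.1)
  rw [hΓ w (hrS (Metric.ball_subset_closedBall hw)) s, ← h1]
  have hne : ∀ z ∈ Metric.sphere c (r : ℝ), z - w ≠ 0 := by
    rintro z hz h
    rw [sub_eq_zero] at h
    rw [h, mem_sphere_iff_norm] at hz
    rw [mem_ball_iff_norm] at hw
    exact hw.ne hz
  have hint2 : CircleIntegrable (fun z => (z - w)⁻¹ • Γ z) c r := by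
    refine ContinuousOn.circleIntegrable r.2 (ContinuousOn.fun_smul ?_
      (hΓc.mono (Metric.sphere_subset_closedBall.trans hrS)))
    exact (continuousOn_id.sub continuousOn_const).inv₀ hne
  have h2 := (ContinuousMap.evalCLM ℂ s : C(unitInterval, ℂ) →L[ℂ] ℂ).intervalIntegral_comp_comm
    hint2.out
  rw [ContinuousMap.smul_apply]
  congr 1
  change _ = (∮ z in C(c, r), (z - w)⁻¹ • Γ z) s
  refine Eq.trans ?_ h2
  simp only [circleIntegral]
  refine intervalIntegral.integral_congr fun θ _ => ?_
  have hmem : circleMap c r θ ∈ S :=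
    hrS (Metric.sphere_subset_closedBall (circleMap_mem_sphere c r.2 θ))
  simp [hΓ _ hmem s]

/-! ### Dilation operators on `H(S)` -/

namespace HolomorphicOn

/-- For `ℓ` a continuous functional on `C([0, 1])`, the operator sending `g` to
`z ↦ ℓ (s ↦ g (s z))`. -/
noncomputable def dilate {S : Opens ℂ} (hS : IsStarShaped S) (ℓ : C(unitInterval, ℂ) →L[ℂ] ℂ)
    (g : HolomorphicOn S) : HolomorphicOn S :=
  ⟨(ℓ : C(C(unitInterval, ℂ), ℂ)).comp (hS.rays g.1), by
    classical
    obtain ⟨G, hG, h⟩ := g.2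
    let Γ : ℂ → C(unitInterval, ℂ) := fun z => if hz : z ∈ S then hS.rays g.1 ⟨z, hz⟩ else 0
    have hΓe : ∀ z (hz : z ∈ S), Γ z = hS.rays g.1 ⟨z, hz⟩ := fun z hz => dif_pos hz
    have hΓc : ContinuousOn Γ S := by
      rw [continuousOn_iff_continuous_domRestrict]
      exact (hS.rays g.1).continuous.congr fun z => (hΓe z z.2).symm
    have hΓ := hS.differentiableOn_rays hG hΓc fun z hz s => by
      rw [hΓe z hz, hS.rays_apply, ← h]
    exact ⟨fun z => ℓ (Γ z), ℓ.differentiable.comp_differentiableOn hΓ, fun z => by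
      exact congrArg ℓ (hΓe z z.2)⟩⟩

theorem continuous_dilate {S : Opens ℂ} (hS : IsStarShaped S)
    (ℓ : C(unitInterval, ℂ) →L[ℂ] ℂ) : Continuous (dilate hS ℓ) :=
  (((ContinuousMap.continuous_postcomp _).comp hS.continuous_rays).comp
    continuous_subtype_val).subtype_mk _

/-- Joint continuity in `(ℓ, z)` gives continuity into the compact-open topology. -/
theorem continuous_dilate_left {S : Opens ℂ} (hS : IsStarShaped S) (g : HolomorphicOn S) :
    Continuous fun ℓ : C(unitInterval, ℂ) →L[ℂ] ℂ => dilate hS ℓ g := by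
  refine Continuous.subtype_mk (f := fun ℓ : C(unitInterval, ℂ) →L[ℂ] ℂ =>
    (ℓ : C(C(unitInterval, ℂ), ℂ)).comp (hS.rays g.1)) ?_ _
  refine ContinuousMap.continuous_of_continuous_uncurry _ ?_
  exact (continuous_fst.clm_apply ((hS.rays g.1).continuous.comp continuous_snd))

/-- Restriction of holomorphic functions to a smaller open set. -/
noncomputable def res {S U : Opens ℂ} (h : S ≤ U) (g : HolomorphicOn U) : HolomorphicOn S :=
  ⟨g.1.comp ⟨Set.inclusion h, continuous_inclusion h⟩, by
    obtain ⟨G, hG, hg⟩ := g.2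
    exact ⟨G, hG.mono h, fun z => hg ⟨z, h z.2⟩⟩⟩

theorem continuous_res {S U : Opens ℂ} (h : S ≤ U) : Continuous (res h) :=
  ((ContinuousMap.continuous_precomp _).comp continuous_subtype_val).subtype_mk _

end HolomorphicOn

namespace RealAnalytic

theorem restrict_res {S U : Opens ℂ} (h : S ≤ U) (hS : ∀ x : ℝ, (x : ℂ) ∈ S)
    (hU : ∀ x : ℝ, (x : ℂ) ∈ U) (g : HolomorphicOn U) :
    restrict S hS (HolomorphicOn.res h g) = restrict U hU g := rfl

/-! ### The universal property of the inductive limit topology -/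

/-- A linear map from `𝒜(ℝ)` to a locally convex space is continuous as soon as its compositions
with all restriction maps are. -/
theorem continuous_of_continuous_comp_restrict {F : Type*} [AddCommGroup F] [Module ℂ F]
    [Module ℝ F] [IsScalarTower ℝ ℂ F] [t : TopologicalSpace F] [IsTopologicalAddGroup F]
    [ContinuousSMul ℂ F] [LocallyConvexSpace ℝ F] (L : RealAnalytic →ₗ[ℂ] F)
    (hL : ∀ (U : Opens ℂ) (hU : ∀ x : ℝ, (x : ℂ) ∈ U), Continuous fun g => L (restrict U hU g)) :
    Continuous L := by
  rw [continuous_iff_le_induced]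
  -- The topology induced by `L` is itself one of the competitors in the infimum.
  refine sInf_le ⟨fun U hU => continuous_induced_rng.2 (hL U hU), ?_, ?_, ?_⟩
  · exact topologicalAddGroup_induced L
  · exact continuousSMul_induced L.toMulActionHom
  · exact LocallyConvexSpace.induced (L.restrictScalars ℝ)

theorem continuous_eval (x : ℝ) : Continuous fun f : RealAnalytic => f x := by
  let L : RealAnalytic →ₗ[ℂ] ℂ :=
    { toFun := fun f => f x, map_add' := fun _ _ => rfl, map_smul' := fun _ _ => rfl }
  refine continuous_of_continuous_comp_restrict L fun U hU => ?_
  exact (continuous_eval_const (⟨(x : ℂ), hU x⟩ : U)).comp continuous_subtype_val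

/-- Makes limits of difference quotients unique, which pins down the generator. -/
instance : T2Space RealAnalytic :=
  .of_injective_continuous DFunLike.coe_injective (continuous_pi continuous_eval)

/-! ### Global holomorphic extensions -/

/-- Local extensions to discs with real centres agree on overlaps by the identity theorem, so they
glue. -/
theorem exists_restrict_eq (f : RealAnalytic) :
    ∃ (U : Opens ℂ) (hU : ∀ x : ℝ, (x : ℂ) ∈ U) (g : HolomorphicOn U), restrict U hU g = f := by
  choose G r hr hG hGf using fun a : ℝ => exists_holomorphic_extension (f.analyticAt a)
  have key : ∀ a b : ℝ, EqOn (G a) (G b) (Metric.ball (a : ℂ) (r a) ∩ Metric.ball (b : ℂ) (r b)) := by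
    intro a b z hz
    -- The centres are real, so a nonempty overlap of two discs meets `ℝ`, where both extensions
    -- equal `f`; being convex, it is connected.
    have hre : ∀ c : ℝ, z ∈ Metric.ball (c : ℂ) (r c) → (z.re : ℂ) ∈ Metric.ball (c : ℂ) (r c) := by
      intro c hc
      rw [mem_ball_iff_norm] at hc ⊢
      refine lt_of_le_of_lt ?_ hc
      rw [← Complex.ofReal_sub, Complex.norm_real, Real.norm_eq_abs]
      simpa using Complex.abs_re_le_norm (z - c)
    have hopen : IsOpen (Metric.ball (a : ℂ) (r a) ∩ Metric.ball (b : ℂ) (r b)) :=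
      Metric.isOpen_ball.inter Metric.isOpen_ball
    have hmem := mem_inter (hre a hz.1) (hre b hz.2)
    refine AnalyticOnNhd.eqOn_of_preconnected_of_frequently_eq
      (((hG a).mono inter_subset_left).analyticOnNhd hopen)
      (((hG b).mono inter_subset_right).analyticOnNhd hopen)
      ((convex_ball _ _).inter (convex_ball _ _)).isPreconnected hmem ?_ hz
    have ht : Tendsto (fun x : ℝ => (x : ℂ)) (𝓝[≠] z.re) (𝓝[≠] (z.re : ℂ)) :=
      (Complex.continuous_ofReal.continuousAt.tendsto).inf
        (tendsto_principal_principal.2 fun x hx => by simpa using hx)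
    refine ht.frequently (Eventually.frequently ?_)
    have h1 := Complex.continuous_ofReal.continuousAt.preimage_mem_nhds (hopen.mem_nhds hmem)
    filter_upwards [nhdsWithin_le_nhds h1] with x hx
    rw [hGf a x hx.1, hGf b x hx.2]
  let U : Opens ℂ := ⟨⋃ a : ℝ, Metric.ball (a : ℂ) (r a), isOpen_iUnion fun _ => Metric.isOpen_ball⟩
  have hU : ∀ x : ℝ, (x : ℂ) ∈ U := fun x => mem_iUnion.2 ⟨x, Metric.mem_ball_self (hr x)⟩
  have hex : ∀ z : ℂ, ∃ a : ℝ, z ∈ U → z ∈ Metric.ball (a : ℂ) (r a) := by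
    intro z
    by_cases hz : z ∈ U
    · obtain ⟨a, ha⟩ := mem_iUnion.1 hz
      exact ⟨a, fun _ => ha⟩
    · exact ⟨0, fun h => absurd h hz⟩
  choose c hc using hex
  have hglue : ∀ a : ℝ, EqOn (fun z => G (c z) z) (G a) (Metric.ball (a : ℂ) (r a)) := fun a z hz =>
    key (c z) a ⟨hc z (mem_iUnion.2 ⟨a, hz⟩), hz⟩
  have hd : DifferentiableOn ℂ (fun z => G (c z) z) U := by
    intro z hz
    obtain ⟨a, ha⟩ := mem_iUnion.1 hz
    have hn := Metric.isOpen_ball.mem_nhds ha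
    exact (((hG a).differentiableAt hn).congr_of_eventuallyEq
      ((hglue a).eventuallyEq_of_mem hn)).differentiableWithinAt
  refine ⟨U, hU, ⟨⟨fun z => G (c z) z, hd.continuousOn.domRestrict⟩, _, hd, fun _ => rfl⟩, ?_⟩
  ext x
  exact hGf _ x (hc x (hU x))

theorem exists_isStarShaped_restrict_eq (f : RealAnalytic) :
    ∃ (S : Opens ℂ) (_ : IsStarShaped S) (hU : ∀ x : ℝ, (x : ℂ) ∈ S) (g : HolomorphicOn S),
      restrict S hU g = f := by
  obtain ⟨U, hU, g, rfl⟩ := f.exists_restrict_eq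
  obtain ⟨S, hS, hSU, hSr⟩ := exists_isStarShaped_le U hU
  exact ⟨S, hS, hSr, HolomorphicOn.res hSU g, restrict_res hSU hSr hU g⟩

/-! ### Dilation operators -/

/-- The function `s ↦ f (s x)` on the unit interval. -/
noncomputable def ray (f : RealAnalytic) (x : ℝ) : C(unitInterval, ℂ) :=
  ⟨fun s => f (s * x), f.continuous_coe.comp (by fun_prop)⟩

theorem ray_apply (f : RealAnalytic) (x : ℝ) (s : unitInterval) : f.ray x s = f (s * x) := rfl

theorem ray_restrict {S : Opens ℂ} (hS : IsStarShaped S) (hU : ∀ x : ℝ, (x : ℂ) ∈ S)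
    (g : HolomorphicOn S) (x : ℝ) : (restrict S hU g).ray x = hS.rays g.1 ⟨x, hU x⟩ := by
  ext s
  refine congrArg g.1 (Subtype.ext ?_)
  exact Complex.ofReal_mul _ _

/-- For `ℓ` a continuous functional on `C([0, 1])`, the operator sending `f` to
`x ↦ ℓ (s ↦ f (s x))`. -/
noncomputable def dilateₗ (ℓ : C(unitInterval, ℂ) →L[ℂ] ℂ) : RealAnalytic →ₗ[ℂ] RealAnalytic where
  toFun f := ⟨fun x => ℓ (f.ray x), by
    obtain ⟨S, hS, hU, g, rfl⟩ := f.exists_isStarShaped_restrict_eq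
    have h : (fun x => ℓ ((restrict S hU g).ray x)) =
        restrict S hU (HolomorphicOn.dilate hS ℓ g) :=
      funext fun x => congrArg ℓ (ray_restrict hS hU g x)
    rw [h]
    exact (restrict S hU (HolomorphicOn.dilate hS ℓ g)).analyticAt⟩
  map_add' f g := by
    ext x
    exact ℓ.map_add (f.ray x) (g.ray x)
  map_smul' c f := by
    ext x
    exact ℓ.map_smul c (f.ray x)

theorem dilateₗ_restrict (ℓ : C(unitInterval, ℂ) →L[ℂ] ℂ) {S : Opens ℂ} (hS : IsStarShaped S)
    (hU : ∀ x : ℝ, (x : ℂ) ∈ S) (g : HolomorphicOn S) :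
    dilateₗ ℓ (restrict S hU g) = restrict S hU (HolomorphicOn.dilate hS ℓ g) := by
  ext x
  exact congrArg ℓ (ray_restrict hS hU g x)

/-- The operator `dilateₗ` as a continuous linear map. -/
noncomputable def dilate (ℓ : C(unitInterval, ℂ) →L[ℂ] ℂ) : RealAnalytic →L[ℂ] RealAnalytic where
  toLinearMap := dilateₗ ℓ
  cont := by
    refine continuous_of_continuous_comp_restrict _ fun U hU => ?_
    obtain ⟨S, hS, hSU, hSr⟩ := exists_isStarShaped_le U hU
    convert (continuous_restrict S hSr).comp
      ((HolomorphicOn.continuous_dilate hS ℓ).comp (HolomorphicOn.continuous_res hSU)) using 2 with g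
    rw [← restrict_res hSU hSr hU g, dilateₗ_restrict ℓ hS]
    rfl

/-- A single `H(S)` contains an extension of `f` and all its images, whatever `ℓ` is. -/
theorem continuous_dilate_left (f : RealAnalytic) : Continuous fun ℓ => dilate ℓ f := by
  obtain ⟨S, hS, hU, g, rfl⟩ := f.exists_isStarShaped_restrict_eq
  exact ((continuous_restrict S hU).comp (HolomorphicOn.continuous_dilate_left hS g)).congr
    fun ℓ => (dilateₗ_restrict ℓ hS hU g).symm

end RealAnalytic

/-- Every element of a complex Banach algebra generates a norm continuous one-parameter group, which
lies in its bicommutant. -/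
theorem exists_uniformly_continuous_group {𝔸 : Type*} [NormedRing 𝔸] [NormedAlgebra ℂ 𝔸]
    [CompleteSpace 𝔸] (b : 𝔸) :
    ∃ e : ℝ → 𝔸, e 0 = 1 ∧ (∀ s t, e (s + t) = e s * e t) ∧ Continuous e ∧
      Tendsto (fun t : ℝ => (t : ℂ)⁻¹ • (e t - 1)) (𝓝[≠] 0) (𝓝 b) ∧
      ∀ x, Commute x b → ∀ t, Commute x (e t) := by
  let _ : NormedAlgebra ℚ 𝔸 := NormedAlgebra.restrictScalars ℚ ℂ 𝔸
  have hd (t : ℝ) : HasDerivAt (fun u : ℝ => NormedSpace.exp ((u : ℂ) • b))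
      (NormedSpace.exp ((t : ℂ) • b) * b) t := by
    have h := (hasDerivAt_exp_smul_const b (t : ℂ)).scomp t Complex.ofRealCLM.hasDerivAt
    rwa [Complex.ofRealCLM_apply, Complex.ofReal_one, one_smul] at h
  refine ⟨fun t => NormedSpace.exp ((t : ℂ) • b), by simp, fun s t => ?_,
    continuous_iff_continuousAt.2 fun t => (hd t).continuousAt, ?_,
    fun x hx t => (hx.smul_right (t : ℂ)).exp_right⟩
  · beta_reduce
    rw [Complex.ofReal_add, add_smul, NormedSpace.exp_add_of_commute
      (((Commute.refl b).smul_left _).smul_right _)]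
  · have h := (hd 0).tendsto_slope
    simp only [Complex.ofReal_zero, zero_smul, NormedSpace.exp_zero, one_mul] at h
    refine h.congr fun t => ?_
    rw [slope_def_module, Complex.ofReal_zero, zero_smul, NormedSpace.exp_zero, sub_zero,
      ← Complex.ofReal_inv]
    exact (Complex.coe_smul _ _).symm

/-! ### Operators on `C([0, 1])` commuting with dilations -/

namespace UnitIntervalOperator

/-- The dilation `h ↦ (r ↦ h (r s))` of `C([0, 1])`. -/
noncomputable def dilation (s : unitInterval) : C(unitInterval, ℂ) →L[ℂ] C(unitInterval, ℂ) :=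
  ContinuousMap.compCLM ℂ ℂ ⟨fun r => r * s, by fun_prop⟩

theorem dilation_apply (s : unitInterval) (h : C(unitInterval, ℂ)) (r : unitInterval) :
    dilation s h r = h (r * s) := rfl

/-- The subalgebra of operators on `C([0, 1])` that commute with all dilations. -/
noncomputable def commutant : Subalgebra ℂ (C(unitInterval, ℂ) →L[ℂ] C(unitInterval, ℂ)) :=
  Subalgebra.centralizer ℂ (range dilation)

theorem mem_commutant {B : C(unitInterval, ℂ) →L[ℂ] C(unitInterval, ℂ)} :
    B ∈ commutant ↔ ∀ s, Commute (dilation s) B := by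
  rw [commutant, Subalgebra.mem_centralizer_iff, forall_mem_range]
  rfl

/-- The functional `h ↦ ∫₀¹ h`. -/
noncomputable def integral : C(unitInterval, ℂ) →L[ℂ] ℂ :=
  LinearMap.mkContinuous
    -- `projIcc` only makes the integrand total; it is the identity on `[0,1]`.
    { toFun := fun h => ∫ q in (0 : ℝ)..1, h (projIcc 0 1 zero_le_one q)
      map_add' := fun h k => intervalIntegral.integral_add
        (Continuous.intervalIntegrable (h.continuous.comp continuous_projIcc) _ _)
        (Continuous.intervalIntegrable (k.continuous.comp continuous_projIcc) _ _)
      map_smul' := fun c h => intervalIntegral.integral_const_mul _ _ } 1 fun h => by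
    have := intervalIntegral.norm_integral_le_of_norm_le_const (a := (0 : ℝ)) (b := 1) (C := ‖h‖)
      (f := fun q => h (projIcc 0 1 zero_le_one q)) fun q _ => h.norm_coe_le_norm _
    simpa using this

theorem integral_apply (h : C(unitInterval, ℂ)) :
    integral h = ∫ q in (0 : ℝ)..1, h (projIcc 0 1 zero_le_one q) := rfl

/-- The Hardy operator `h ↦ (r ↦ ∫₀¹ h (q r) dq)` on `C([0, 1])`. -/
noncomputable def hardy : C(unitInterval, ℂ) →L[ℂ] C(unitInterval, ℂ) where
  toFun h := ContinuousMap.comp (integral : C(C(unitInterval, ℂ), ℂ))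
    (ContinuousMap.curry ⟨fun p => h (p.2 * p.1), by fun_prop⟩)
  map_add' h k := by
    ext r
    exact integral.map_add (dilation r h) (dilation r k)
  map_smul' c h := by
    ext r
    exact integral.map_smul c (dilation r h)
  cont := by
    refine (ContinuousMap.continuous_postcomp _).comp (ContinuousMap.continuous_curry.comp ?_)
    exact ContinuousMap.continuous_precomp (X := unitInterval × unitInterval)
      ⟨fun p => p.2 * p.1, by fun_prop⟩

theorem hardy_apply (h : C(unitInterval, ℂ)) (r : unitInterval) :
    hardy h r = integral (dilation r h) := rfl

theorem hardy_mem_commutant : hardy ∈ commutant := by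
  refine mem_commutant.2 fun s => ?_
  ext h r
  change integral (dilation (r * s) h) = integral (dilation r (dilation s h))
  congr 1
  ext q
  simp only [dilation_apply, mul_assoc]

end UnitIntervalOperator

/-! ### Lifting operators from `C([0,1])` to `𝒜(ℝ)` -/

namespace RealAnalytic

open UnitIntervalOperator

/-- The operator on `𝒜(ℝ)` sending `f` to `x ↦ B (s ↦ f (s x)) 1`. -/
noncomputable def lift (B : C(unitInterval, ℂ) →L[ℂ] C(unitInterval, ℂ)) : RealAnalytic →L[ℂ] RealAnalytic :=
  dilate ((ContinuousMap.evalCLM ℂ 1).comp B)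

theorem lift_apply (B : C(unitInterval, ℂ) →L[ℂ] C(unitInterval, ℂ)) (f : RealAnalytic) (x : ℝ) :
    lift B f x = B (f.ray x) 1 := rfl

/-- Evaluation at `s` is dilation by `s` followed by evaluation at `1`; moving the dilation through
`B` turns `f_x` into `f_{sx}`. -/
theorem ray_lift {B : C(unitInterval, ℂ) →L[ℂ] C(unitInterval, ℂ)} (hB : B ∈ commutant)
    (f : RealAnalytic) (x : ℝ) : (lift B f).ray x = B (f.ray x) := by
  ext s
  have h1 : f.ray (s * x) = dilation s (f.ray x) := by
    ext r
    simp only [ray_apply, dilation_apply, Icc.coe_mul, mul_assoc]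
  have h2 := DFunLike.congr_fun (mem_commutant.1 hB s).eq (f.ray x)
  simp only [mul_apply_eq_comp] at h2
  rw [ray_apply, lift_apply, h1, ← h2, dilation_apply, one_mul]

/-- Only the inner factor has to commute with dilations, since `B` is applied to rays of `lift C f`.
-/
theorem lift_mul (B : C(unitInterval, ℂ) →L[ℂ] C(unitInterval, ℂ))
    {C : C(unitInterval, ℂ) →L[ℂ] C(unitInterval, ℂ)} (hC : C ∈ commutant) :
    lift (B * C) = (lift B).comp (lift C) := by
  ext f x
  rw [ContinuousLinearMap.comp_apply, lift_apply, lift_apply, ray_lift hC]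
  rfl

theorem lift_one : lift 1 = ContinuousLinearMap.id ℂ RealAnalytic := by
  ext f x
  simp [lift_apply, ray_apply]

/-- Substitute `y = qx`; at `x = 0` the integrand is the constant `f 0`. -/
theorem lift_hardy : (lift UnitIntervalOperator.hardy : RealAnalytic →ₗ[ℂ] RealAnalytic) = hardy := by
  ext f x
  have h1 : lift UnitIntervalOperator.hardy f x = ∫ q in (0 : ℝ)..1, f (q * x) := by
    rw [lift_apply, hardy_apply, integral_apply]
    refine intervalIntegral.integral_congr fun q hq => ?_
    rw [uIcc_of_le zero_le_one] at hq
    simp [dilation_apply, ray_apply, projIcc_of_mem zero_le_one hq]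
  change lift UnitIntervalOperator.hardy f x = hardyFun f x
  rw [h1, hardyFun]
  split_ifs with hx
  · simp [hx]
  · rw [intervalIntegral.integral_comp_mul_right _ hx]
    simp

theorem lift_hardy_pow (k : ℕ) :
    (lift (UnitIntervalOperator.hardy ^ k) : RealAnalytic →ₗ[ℂ] RealAnalytic) = hardy ^ k := by
  induction k with
  | zero => rw [pow_zero, pow_zero, lift_one]; rfl
  | succ k ih =>
    rw [pow_succ, pow_succ, lift_mul _ hardy_mem_commutant, ← ih, ← lift_hardy]
    rfl

theorem lift_sum_hardy (K : ℕ) (a : ℕ → ℂ) :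
    (lift (∑ k ∈ Finset.range (K + 1), a k • UnitIntervalOperator.hardy ^ k) :
      RealAnalytic →ₗ[ℂ] RealAnalytic) = ∑ k ∈ Finset.range (K + 1), a k • hardy ^ k := by
  let e : (C(unitInterval, ℂ) →L[ℂ] C(unitInterval, ℂ)) →ₗ[ℂ] RealAnalytic →ₗ[ℂ] RealAnalytic :=
    { toFun := fun B => lift B, map_add' := fun _ _ => rfl, map_smul' := fun _ _ => rfl }
  change e _ = _
  rw [map_sum]
  refine Finset.sum_congr rfl fun k _ => ?_
  rw [map_smul, ← lift_hardy_pow]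
  rfl

theorem continuous_lift_left (f : RealAnalytic) : Continuous fun B => lift B f :=
  (continuous_dilate_left f).comp (continuous_const.clm_comp continuous_id)

/-- The operator induced by a bounded operator commuting with dilations generates a `C₀`-group. -/
theorem generatesC0Group_lift {B : C(unitInterval, ℂ) →L[ℂ] C(unitInterval, ℂ)}
    (hB : B ∈ commutant) :
    GeneratesC0Group (lift B : RealAnalytic →ₗ[ℂ] RealAnalytic) := by
  obtain ⟨e, h0, hadd, hcont, hslope, hcomm⟩ := exists_uniformly_continuous_group B
  -- Dilations commute with `B`, and `e t` lies in the bicommutant of `B`.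
  have hmem : ∀ t : ℝ, e t ∈ commutant := fun t =>
    mem_commutant.2 fun s => hcomm _ (mem_commutant.1 hB s) t
  have hderiv (f : RealAnalytic) :
      Tendsto (fun t : ℝ => ((t : ℂ)⁻¹) • (lift (e t) f - f)) (𝓝[≠] 0) (𝓝 (lift B f)) := by
    -- `lift` is linear in the operator, so the norm limit of `(e t - 1) / t` carries over to the
    -- orbit of `f`.
    refine (((continuous_lift_left f).tendsto B).comp hslope).congr fun t => ?_
    ext x
    change (t : ℂ)⁻¹ * (e t (f.ray x) 1 - f.ray x 1) = (t : ℂ)⁻¹ * (e t (f.ray x) 1 - f x)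
    simp [ray_apply]
  refine ⟨fun t => lift (e t), ⟨fun s t => ?_, ?_, fun f s => ?_⟩, ?_⟩
  · rw [hadd, lift_mul _ (hmem t)]
  · rw [h0, lift_one]
  · exact ((continuous_lift_left f).comp hcont).tendsto s
  · ext p
    refine ⟨fun h => tendsto_nhds_unique h (hderiv p.1), fun h => ?_⟩
    have h' : p.2 = lift B p.1 := h
    change Tendsto _ _ (𝓝 p.2)
    rw [h']
    exact hderiv p.1

end RealAnalytic

theorem mainTheorem4 (K : ℕ) (a : ℕ → ℂ) :
    Continuous RealAnalytic.hardy ∧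
      GeneratesC0Group (∑ k ∈ Finset.range (K + 1), a k • RealAnalytic.hardy ^ k) := by
  constructor
  · rw [← RealAnalytic.lift_hardy]
    exact (RealAnalytic.lift UnitIntervalOperator.hardy).continuous
  · rw [← RealAnalytic.lift_sum_hardy]
    exact RealAnalytic.generatesC0Group_lift <| Subalgebra.sum_mem _ fun k _ =>
      Subalgebra.smul_mem _ (Subalgebra.pow_mem _ UnitIntervalOperator.hardy_mem_commutant k) _
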